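/- Let $n \ge 2$ be a fixed integer. A deterministic linear context-free language is a language $L \subseteq \Sigma^*$ over some finite alphabet $\Sigma$ that is accepted (by final state) by a deterministic pushdown automaton which makes at most one reversal of its stack, i.e. in none of its computations does the stack height increase at some move after having decreased at an earlier move. Then it is undecidable for deterministic linear context-free languages $L \subseteq \Sigma^*$ whether there exists a nonempty word $w \in \Sigma^*$ with $w^n \in L$. That is, there is no algorithm which, given a deterministic pushdown automaton making at most one reversal (and accepting a language $L\subseteq\Sigma^*$), always halts and decides correctly whether $w^n \in L$ for some nonempty $w \in \Sigma^*$. -/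

import Mathlib

/-- A transition of a pushdown automaton. In state `source`, with `pop` on top of the stack, the
automaton may read `input` (a letter, or nothing if `input = none`), enter the state `target` and
replace the top symbol `pop` by the word `push` (whose first symbol becomes the new top). -/
structure PDARule where
  source : ℕ
  input : Option ℕ
  pop : ℕ
  target : ℕ
  push : List ℕ

/-- A pushdown automaton as a finite object. States, input letters and stack symbols are named by
natural numbers; as there are finitely many rules, only finitely many of them are in use, and the
input alphabet is the finite set of the letters that occur in the rules. -/
structure PDA where
  rules : List PDARule
  start : ℕ
  bottom : ℕ
  final : List ℕ

/-- A rule as a tuple, used only to code rules by natural numbers. -/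
def PDARule.equivTuple : PDARule ≃ ℕ × Option ℕ × ℕ × ℕ × List ℕ where
  toFun r := (r.source, r.input, r.pop, r.target, r.push)
  invFun t := ⟨t.1, t.2.1, t.2.2.1, t.2.2.2.1, t.2.2.2.2⟩
  left_inv _ := rfl
  right_inv _ := rfl

instance PDARule.instPrimcodable : Primcodable PDARule :=
  Primcodable.ofEquiv _ PDARule.equivTuple

/-- An automaton as a tuple, used only to code automata by natural numbers. -/
def PDA.equivTuple : PDA ≃ List PDARule × ℕ × ℕ × List ℕ where
  toFun M := (M.rules, M.start, M.bottom, M.final)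
  invFun t := ⟨t.1, t.2.1, t.2.2.1, t.2.2.2⟩
  left_inv _ := rfl
  right_inv _ := rfl

instance PDA.instPrimcodable : Primcodable PDA :=
  Primcodable.ofEquiv _ PDA.equivTuple

/-- A configuration: current state, the part of the input not yet read, the stack (top first). -/
structure PDAConfig where
  state : ℕ
  input : List ℕ
  stack : List ℕ

namespace PDA

/-- One move of the automaton: a rule is applied to the top of the stack. -/
inductive Step (M : PDA) : PDAConfig → PDAConfig → Prop
  | apply (r : PDARule) (hr : r ∈ M.rules) (x γ : List ℕ) :
      Step M ⟨r.source, r.input.toList ++ x, r.pop :: γ⟩ ⟨r.target, x, r.push ++ γ⟩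

/-- Finitely many (possibly zero) moves. -/
def Reaches (M : PDA) : PDAConfig → PDAConfig → Prop :=
  Relation.ReflTransGen M.Step

/-- The initial configuration on the input `x`. -/
def init (M : PDA) (x : List ℕ) : PDAConfig := ⟨M.start, x, [M.bottom]⟩

/-- The accepted language: the words that can be read completely, ending in a final state. -/
def language (M : PDA) : Language ℕ :=
  {x | ∃ q ∈ M.final, ∃ γ : List ℕ, M.Reaches (M.init x) ⟨q, [], γ⟩}

/-- In each state and for each top symbol, there is at most one rule for each letter, and if there
is a rule that reads no letter, then it is the only rule. -/
def IsDeterministic (M : PDA) : Prop :=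
  ∀ r ∈ M.rules, ∀ s ∈ M.rules, r.source = s.source → r.pop = s.pop →
    (r.input = s.input ∨ r.input = none ∨ s.input = none) → r = s

/-- At most one reversal of the stack: in every computation, on every input, no move that
increases the stack height comes after a move that decreases it. -/
def IsOneTurn (M : PDA) : Prop :=
  ∀ (x : List ℕ) (c₁ c₂ c₃ c₄ : PDAConfig),
    M.Reaches (M.init x) c₁ → M.Step c₁ c₂ → M.Reaches c₂ c₃ → M.Step c₃ c₄ →
      c₂.stack.length < c₁.stack.length → c₄.stack.length ≤ c₃.stack.length

/-- A deterministic linear pushdown automaton. The languages accepted by these are the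
deterministic linear context-free languages. -/
def IsDeterministicLinear (M : PDA) : Prop :=
  M.IsDeterministic ∧ M.IsOneTurn

end PDA

/-- The power `w ^ n` of a word, `n` copies of `w` one after the other. -/
def wordPow (w : List ℕ) (n : ℕ) : List ℕ := (List.replicate n w).flatten

/-- The property `P` of the instances satisfying `D` is (algorithmically) decidable: some partial
recursive function halts on all instances satisfying `D` and tells correctly whether `P` holds.
Nothing is required of it on other instances. -/
def DecidableOn {α : Type*} [Primcodable α] (D P : α → Prop) : Prop :=
  ∃ f : α →. Bool, Partrec f ∧ ∀ a, D a → ∃ b ∈ f a, (b = true ↔ P a)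

/-! The halting problem is reduced to the question about powers, by way of queue machines. Let `u`
be the word of all letters that a queue machine removes before halting with empty queue, and `z` the
word of all letters it appends. Then `u = c ++ z`, where `c` is the initial queue; conversely, such
a run exists as soon as `δ`, read as a transducer, turns some `u` into `z` with `u = c ++ z`. So
halting is a single equation between the input and the output of a finite transducer.

With separators 0 and 1, a one-turn automaton accepts the words `u 0 y 1 u' 0 y' 1 v` such that `u'`
is transduced to some `z`, `y` reversed is `c ++ z`, `y'` is `u` reversed, and `v` has `n - 2` ones
and is empty or ends in 1. It pushes `u 0 y`, then pops `y` while reading `u'` and `u` while reading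
`y'`. In an `n`-th power the blocks coincide, so `u = u'`, `y = y'`, and the two comparisons
together say `u = c ++ z` (`exists_power_mem_language_iff`).

Queue machines are universal: a partial recursive function is computed by a `TM2` machine with four
stacks, each of its statements is a move on one stack, and a queue simulates a move by one full
rotation (`consumes_step`, `eval_dom_iff_exists_consumes`). The machine is fixed and only `c = a₀ ^
x ++ b₀ :: l₀` depends on the input `x`, so the automata form a primitive recursive family. -/

/-! ### Queue machines -/

/-- A queue machine with states `Q` and letters `A`. In each round a non-halting machine removes the
letter at the front of the queue, appends a word to its end and changes its state. -/
abbrev QueueMachine (Q A : Type*) := Q → Option (A → List A × Q)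

namespace QueueMachine

variable {Q A : Type*} (δ : QueueMachine Q A)

/-- Viewed as a transducer, `δ` reads `x`, writes `z` and ends in a halting state. -/
inductive Transduces : Q → List A → List A → Prop
  | halt {q} : δ q = none → Transduces q [] []
  | read {q f a x z} : δ q = some f → Transduces (f a).2 x z → Transduces q (a :: x) ((f a).1 ++ z)

/-- The word of all letters ever removed from the queue, which is of length `n`, is the content `c`
of the queue followed by the letters appended to it. -/
def Consumes (n : ℕ) (q : Q) (c : List A) : Prop :=
  ∃ x z, x.length = n ∧ δ.Transduces q x z ∧ x = c ++ z

variable {δ}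

theorem consumes_halt {q : Q} (h : δ q = none) : δ.Consumes 0 q [] :=
  ⟨[], [], rfl, .halt h, rfl⟩

/-- Cancelling the front letter in `x = c ++ z` moves the first word written from `z` to the end of
the queue. Thus the static equation behaves like a run of `n` rounds, and simulations can be checked
round by round. -/
theorem consumes_cons {q : Q} {f : A → List A × Q} (h : δ q = some f) {n : ℕ} {a : A}
    {c : List A} : δ.Consumes (n + 1) q (a :: c) ↔ δ.Consumes n (f a).2 (c ++ (f a).1) := by
  constructor
  · rintro ⟨x, z, hx, ht, e⟩
    cases ht with
    | halt => simp at hx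
    | read h' ht =>
      rw [h, Option.some.injEq] at h'
      subst h'
      rw [List.cons_append, List.cons.injEq] at e
      obtain ⟨rfl, e⟩ := e
      exact ⟨_, _, by simpa using hx, ht, by simpa using e⟩
  · rintro ⟨x, z, hx, ht, e⟩
    exact ⟨_, _, by simp [hx], .read (a := a) h ht, by simp [e]⟩

theorem Consumes.length_le {n : ℕ} {q : Q} {c : List A} (h : δ.Consumes n q c) :
    c.length ≤ n := by
  obtain ⟨x, z, hx, -, e⟩ := h
  simp [← hx, e]

theorem consumes_copy {q : Q} {f : A → List A × Q} (h : δ q = some f) {u c : List A}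
    (hu : ∀ a ∈ u, f a = ([a], q)) {n : ℕ} :
    δ.Consumes (n + u.length) q (u ++ c) ↔ δ.Consumes n q (c ++ u) := by
  induction u generalizing c with
  | nil => simp
  | cons a u ih =>
    rw [List.length_cons, ← add_assoc, List.cons_append, consumes_cons h,
      hu a List.mem_cons_self, List.append_assoc, ih fun b hb => hu b (List.mem_cons_of_mem _ hb)]
    simp

theorem consumes_erase {q : Q} {f : A → List A × Q} (h : δ q = some f) {u c : List A}
    (hu : ∀ a ∈ u, f a = ([], q)) {n : ℕ} :
    δ.Consumes (n + u.length) q (u ++ c) ↔ δ.Consumes n q c := by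
  induction u with
  | nil => simp
  | cons a u ih =>
    rw [List.length_cons, ← add_assoc, List.cons_append, consumes_cons h,
      hu a List.mem_cons_self, List.append_nil, ih fun b hb => hu b (List.mem_cons_of_mem _ hb)]

end QueueMachine

/-! ### Simulation of several stacks by one queue -/

/-- A machine with states `P` and finitely many stacks, indexed by `K`. In each move a non-halting
machine replaces the top symbol of one stack (if there is one) by a word and changes its state. -/
abbrev StackMachine (P K Γ : Type*) := P → Option (K × (Option Γ → List Γ × P))

namespace StackMachine

/-- Letters of the queue machine that simulates a stack machine: `none` marks the end of the queue,
`some (.inl k)` the beginning of the `k`-th stack. -/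
abbrev Letter (K Γ : Type*) := Option (K ⊕ Γ)

/-- States of the queue machine that simulates a stack machine. -/
inductive QueueState (P : Type*)
  | search (p : P)
  | look (p : P)
  | copy (p : P)
  | halt

instance {P : Type*} [Finite P] : Finite (QueueState P) :=
  Finite.of_surjective (α := Option (P ⊕ P ⊕ P))
    (fun | none => .halt | some (.inl p) => .search p | some (.inr (.inl p)) => .look p
         | some (.inr (.inr p)) => .copy p)
    (by rintro (p | p | p | _)
        exacts [⟨some (.inl p), rfl⟩, ⟨some (.inr (.inl p)), rfl⟩, ⟨some (.inr (.inr p)), rfl⟩,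
          ⟨none, rfl⟩])

variable {P K Γ : Type*}

/-- The symbols of a stack as letters of a queue. -/
def syms (l : List Γ) : List (Letter K Γ) := l.map fun g => some (.inr g)

/-- The stacks with indices in `ks`, one after the other. -/
def blocks (S : K → List Γ) (ks : List K) : List (Letter K Γ) :=
  ks.flatMap fun k => some (.inl k) :: syms (S k)

theorem none_notMem_syms (l : List Γ) : none ∉ (syms l : List (Letter K Γ)) := by
  simp [syms]

theorem none_notMem_blocks (S : K → List Γ) (ks : List K) : none ∉ blocks S ks := by
  simp [blocks, syms]

/-- The queue that stands for the contents `S` of the stacks with indices `ks`. -/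
def queue (S : K → List Γ) (ks : List K) : List (Letter K Γ) := blocks S ks ++ [none]

/-- One move of the stack machine, as a function of the top of the stack and the next letter. -/
def lookRule (h : Option Γ → List Γ × P) : Letter K Γ → List (Letter K Γ) × QueueState P
  | some (.inr g) => (syms (h (some g)).1, .copy (h (some g)).2)
  | some (.inl k) => (syms (h none).1 ++ [some (.inl k)], .copy (h none).2)
  | none => (syms (h none).1 ++ [none], .search (h none).2)

variable [DecidableEq K]

/-- The simulating queue machine: it rotates the queue once for each move. -/
def toQueue (M : StackMachine P K Γ) : QueueMachine (QueueState P) (Letter K Γ)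
  | .search p => match M p with
    | none => some fun a => ([], if a.isNone then .halt else .search p)
    | some (k, _) => some fun a => match a with
      | some (.inl k') => ([a], if k' = k then .look p else .search p)
      | _ => ([a], .search p)
  | .look p => (M p).map fun kh => lookRule kh.2
  | .copy p => some fun a => ([a], if a.isNone then .search p else .copy p)
  | .halt => none

variable {M : StackMachine P K Γ}

/-- The end mark `none` stops the copying; it is itself sent to the back, which completes the
rotation. -/
theorem consumes_copy_state {p : P} {u v : List (Letter K Γ)} (hu : none ∉ u) {n : ℕ} :
    M.toQueue.Consumes (n + 1 + u.length) (.copy p) (u ++ none :: v) ↔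
      M.toQueue.Consumes n (.search p) (v ++ u ++ [none]) := by
  rw [QueueMachine.consumes_copy (f := fun a => ([a], if a.isNone then .search p else .copy p)) rfl,
    List.cons_append, QueueMachine.consumes_cons rfl]
  · simp
  · rintro (_ | a) ha
    · exact absurd ha hu
    · rfl

theorem blocks_update {S : K → List Γ} {k : K} {ks : List K} (h : k ∉ ks) (l : List Γ) :
    blocks (Function.update S k l) ks = blocks S ks := by
  unfold blocks
  refine List.flatMap_congr fun k' hk' => ?_
  rw [Function.update_of_ne]
  rintro rfl
  exact h hk'

/-- One rotation: `search` copies up to the marker of stack `k`, `look` rewrites the top of that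
stack, and `copy` moves the rest. Each letter of the old queue is removed exactly once, whence the
number of rounds. -/
theorem consumes_step {p : P} {k : K} {h : Option Γ → List Γ × P} (hM : M p = some (k, h))
    {ks : List K} (hks : ks.Nodup) (hk : k ∈ ks) (S : K → List Γ) (n : ℕ) :
    M.toQueue.Consumes (n + (queue S ks).length) (.search p) (queue S ks) ↔
      M.toQueue.Consumes n (.search (h (S k).head?).2)
        (queue (Function.update S k ((h (S k).head?).1 ++ (S k).tail)) ks) := by
  obtain ⟨k₁, k₂, rfl⟩ := List.append_of_mem hk
  have hk₁ : k ∉ k₁ := fun hm => (List.disjoint_of_nodup_append hks hm) List.mem_cons_self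
  have hk₂ : k ∉ k₂ := (List.nodup_cons.1 hks.of_append_right).1
  have hq : queue S (k₁ ++ k :: k₂) =
      blocks S k₁ ++ some (.inl k) :: (syms (S k) ++ blocks S k₂ ++ [none]) := by
    simp [queue, blocks]
  have hq' (l : List Γ) : queue (Function.update S k l) (k₁ ++ k :: k₂) =
      blocks S k₁ ++ some (.inl k) :: (syms l ++ blocks S k₂ ++ [none]) := by
    rw [← blocks_update hk₁ l, ← blocks_update hk₂ l]
    simp [queue, blocks]
  rw [hq, hq']
  have hsearch {m : ℕ} {c : List (Letter K Γ)} (n : ℕ)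
      (hm : m = n + 1 + (blocks S k₁).length) :
      M.toQueue.Consumes m (.search p) (blocks S k₁ ++ some (.inl k) :: c) ↔
      M.toQueue.Consumes n (.look p) (c ++ blocks S k₁ ++ [some (.inl k)]) := by
    have hf : M.toQueue (.search p) = some fun a => match a with
      | some (.inl k') => ([a], if k' = k then .look p else .search p)
      | _ => ([a], .search p) := by simp [toQueue, hM]
    rw [hm, QueueMachine.consumes_copy hf, List.cons_append, QueueMachine.consumes_cons hf]
    · simp
    · simp only [blocks, List.mem_flatMap]
      rintro a ⟨k', hk', ha⟩
      rcases List.mem_cons.1 ha with rfl | ha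
      · have : k' ≠ k := fun e => hk₁ (e ▸ hk')
        simp [this]
      · obtain ⟨g, -, rfl⟩ := List.mem_map.1 ha
        rfl
  have hlook : M.toQueue (.look p) = some (lookRule h) := by simp [toQueue, hM]
  have hu : none ∉ blocks S k₂ := none_notMem_blocks _ _
  cases hS : S k with
  | cons g l =>
    rw [hsearch (n + 1 + (syms (K := K) l ++ blocks S k₂).length + 1) (by simp [syms]; omega)]
    simp only [syms, List.map_cons, List.cons_append]
    rw [QueueMachine.consumes_cons hlook]
    have := consumes_copy_state (M := M) (p := (h (some g)).2) (u := syms l ++ blocks S k₂)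
      (v := blocks S k₁ ++ some (.inl k) :: syms (h (some g)).1) (n := n)
      (by simp [hu, none_notMem_syms])
    simpa [lookRule, syms] using this
  -- For an empty stack the letter seen by `look` is the end mark or the marker of the next stack,
  -- and the pushed word is inserted before it. The end mark already finishes the rotation, so the
  -- copying phase is then absent.
  | nil =>
    cases hb : blocks S k₂ with
    | nil =>
      rw [hsearch (n + 1) (by simp [syms]; omega)]
      simp only [syms, List.map_nil, List.nil_append, List.cons_append]
      rw [QueueMachine.consumes_cons hlook]
      simp [lookRule, syms]
    | cons a u =>
      obtain ⟨k', rfl⟩ : ∃ k', a = some (.inl k') := by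
        cases k₂ with
        | nil => simp [blocks] at hb
        | cons k' _ =>
          simp only [blocks, List.flatMap_cons, List.cons_append, List.cons.injEq] at hb
          exact ⟨k', hb.1.symm⟩
      rw [hb] at hu
      rw [hsearch (n + 1 + u.length + 1) (by simp [syms]; omega)]
      simp only [syms, List.map_nil, List.nil_append, List.cons_append]
      rw [QueueMachine.consumes_cons hlook]
      have := consumes_copy_state (M := M) (p := (h none).2) (u := u)
        (v := blocks S k₁ ++ some (.inl k) :: (syms (h none).1 ++ [some (.inl k')])) (n := n)
        (by simp_all)
      simpa [lookRule, syms] using this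

/-- `Consumes` allows halting only with an empty queue, so a halting stack machine is simulated by
erasing everything up to the end mark. -/
theorem exists_consumes_of_halt {p : P} (hM : M p = none) (S : K → List Γ) (ks : List K) :
    ∃ n, M.toQueue.Consumes n (.search p) (queue S ks) := by
  have hf : M.toQueue (.search p) =
      some fun a => ([], if a.isNone then .halt else .search p) := by simp [toQueue, hM]
  refine ⟨0 + 1 + (blocks S ks).length, ?_⟩
  rw [queue, QueueMachine.consumes_erase hf, QueueMachine.consumes_cons hf]
  · exact QueueMachine.consumes_halt rfl
  · rintro (_ | a) ha
    · exact absurd ha (none_notMem_blocks _ _)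
    · rfl

end StackMachine

/-! ### From `TM2` machines to stack machines -/

namespace Turing.TM2

variable {K Γ Λ σ : Type*} (M : Λ → Stmt (fun _ : K => Γ) Λ σ) (S₀ : Finset Λ)

/-- The states of the stack machine that simulates the labels `S₀` of `M`: what is left of the
current statement, and the value of the local variable. -/
abbrev StackState := {q : Option (Stmt (fun _ : K => Γ) Λ σ) // q ∈ stmts M S₀} × σ

variable {M S₀} in
open Classical in
/-- The state given by a statement, if that statement is in use. -/
noncomputable def toState (q : Option (Stmt (fun _ : K => Γ) Λ σ)) (v : σ) : StackState M S₀ :=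
  (if h : q ∈ stmts M S₀ then ⟨q, h⟩ else ⟨none, Finset.none_mem_insertNone⟩, v)

/-- A machine with single moves that simulates `M`. -/
noncomputable def toStackMachine (k₀ : K) : StackMachine (StackState M S₀) K Γ
  | (⟨none, _⟩, _) => none
  | (⟨some q, _⟩, v) => match q with
    | .push k f q => some (k, fun t => (f v :: t.toList, toState (some q) v))
    | .peek k f q => some (k, fun t => (t.toList, toState (some q) (f v t)))
    | .pop k f q => some (k, fun t => ([], toState (some q) (f v t)))
    | .load f q => some (k₀, fun t => (t.toList, toState (some q) (f v)))
    | .branch f q₁ q₂ => some (k₀, fun t => (t.toList, toState (some (cond (f v) q₁ q₂)) v))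
    | .goto l => some (k₀, fun t => (t.toList, toState (some (M (l v))) v))
    | .halt => some (k₀, fun t => (t.toList, toState none v))

variable {M S₀}

theorem toState_of_mem {q : Option (Stmt (fun _ : K => Γ) Λ σ)} (h : q ∈ stmts M S₀) (v : σ) :
    toState q v = (⟨q, h⟩, v) := by
  simp [toState, h]

theorem stmt_mem_stmts {l : Λ} (hl : l ∈ S₀) : some (M l) ∈ stmts M S₀ := by
  simp only [stmts, Finset.some_mem_insertNone, Finset.mem_biUnion]
  exact ⟨l, hl, stmts₁_self⟩

/-- The state of the stack machine at the beginning of a move of `M`. -/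
noncomputable def Cfg.toState (M : Λ → Stmt (fun _ : K => Γ) Λ σ) (S₀ : Finset Λ)
    (c : Cfg (fun _ : K => Γ) Λ σ) : StackState M S₀ :=
  TM2.toState (c.l.map M) c.var

theorem _root_.List.toList_head?_append_tail {α : Type*} (l : List α) :
    l.head?.toList ++ l.tail = l := by
  cases l <;> rfl

variable [DecidableEq K]

open QueueMachine StackMachine

variable (M S₀) in
/-- The queue machine gets from the state `p` and the stacks `S` to the configuration `c` of `M`,
with at least one round. -/
def LeadsTo (k₀ : K) (ks : List K) (p : StackState M S₀) (S : K → List Γ)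
    (c : Cfg (fun _ : K => Γ) Λ σ) : Prop :=
  ∃ d, 0 < d ∧
    (∀ n, (toStackMachine M S₀ k₀).toQueue.Consumes (n + d) (.search p) (queue S ks) ↔
      (toStackMachine M S₀ k₀).toQueue.Consumes n (.search (c.toState M S₀)) (queue c.stk ks)) ∧
    ∀ n < d, ¬ (toStackMachine M S₀ k₀).toQueue.Consumes n (.search p) (queue S ks)

variable {k₀ : K} {ks : List K} {S : K → List Γ} {c : Cfg (fun _ : K => Γ) Λ σ}
  {q : Stmt (fun _ : K => Γ) Λ σ} {v : σ} {k : K} {h : Option Γ → List Γ × StackState M S₀}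

/-- The rounds of the rotation are added to those of the rest. Fewer rounds cannot suffice, as every
letter in the queue has to be removed. -/
theorem LeadsTo.move (hks : ks.Nodup) (hk : k ∈ ks) (hq : some q ∈ stmts M S₀)
    (e : toStackMachine M S₀ k₀ (⟨some q, hq⟩, v) = some (k, h))
    (ih : LeadsTo M S₀ k₀ ks (h (S k).head?).2
      (Function.update S k ((h (S k).head?).1 ++ (S k).tail)) c) :
    LeadsTo M S₀ k₀ ks (toState (some q) v) S c := by
  have H := consumes_step e hks hk S
  obtain ⟨d', hd', H', H''⟩ := ih
  refine ⟨d' + (queue S ks).length, by omega, fun n => ?_, fun n hn hc => ?_⟩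
  · rw [← add_assoc, toState_of_mem hq, H, H']
  · obtain ⟨m, rfl⟩ := Nat.exists_eq_add_of_le' hc.length_le
    rw [toState_of_mem hq, H] at hc
    exact H'' m (by omega) hc

/-- For statements that touch no stack: the move puts the top of a dummy stack back. -/
theorem LeadsTo.skip (hks : ks.Nodup) (hk : k ∈ ks) (hq : some q ∈ stmts M S₀)
    {p : StackState M S₀}
    (e : toStackMachine M S₀ k₀ (⟨some q, hq⟩, v) = some (k, fun t => (t.toList, p)))
    (ih : LeadsTo M S₀ k₀ ks p S c) : LeadsTo M S₀ k₀ ks (toState (some q) v) S c := by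
  refine .move hks hk hq e ?_
  rwa [List.toList_head?_append_tail, Function.update_eq_self]

theorem LeadsTo.last (hks : ks.Nodup) (hk : k ∈ ks) (hq : some q ∈ stmts M S₀)
    (e : toStackMachine M S₀ k₀ (⟨some q, hq⟩, v) = some (k, fun t => (t.toList, c.toState M S₀)))
    (hc : c.stk = S) : LeadsTo M S₀ k₀ ks (toState (some q) v) S c := by
  have H := consumes_step e hks hk S
  refine ⟨(queue S ks).length, by simp [queue], fun n => ?_, fun n hn hc => ?_⟩
  · rw [toState_of_mem hq, H, List.toList_head?_append_tail, Function.update_eq_self, hc]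
  · exact absurd hc.length_le (by omega)

theorem leadsTo_stepAux (hks : ks.Nodup) (hk : ∀ k, k ∈ ks) (hq : some q ∈ stmts M S₀) :
    LeadsTo M S₀ k₀ ks (toState (some q) v) S (stepAux q v S) := by
  induction q generalizing v S with
  | push k f q ih =>
    refine .move hks (hk _) hq rfl ?_
    simp only [List.cons_append, List.toList_head?_append_tail]
    exact ih (stmts_trans (by simp [stmts₁, stmts₁_self]) hq)
  | peek k f q ih =>
    refine .move hks (hk _) hq rfl ?_
    simp only [List.toList_head?_append_tail, Function.update_eq_self]
    exact ih (stmts_trans (by simp [stmts₁, stmts₁_self]) hq)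
  | pop k f q ih =>
    exact .move hks (hk _) hq rfl (ih (stmts_trans (by simp [stmts₁, stmts₁_self]) hq))
  | load f q ih =>
    exact .skip hks (hk _) hq rfl (ih (stmts_trans (by simp [stmts₁, stmts₁_self]) hq))
  | branch f q₁ q₂ ih₁ ih₂ =>
    refine .skip hks (hk _) hq rfl ?_
    rw [stepAux]
    cases f v
    · exact ih₂ (stmts_trans (by simp [stmts₁, stmts₁_self]) hq)
    · exact ih₁ (stmts_trans (by simp [stmts₁, stmts₁_self]) hq)
  | goto l => exact .last (k := k₀) hks (hk _) hq rfl rfl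
  | halt => exact .last (k := k₀) hks (hk _) hq rfl rfl

theorem eval_dom_iff_exists_consumes [Inhabited Λ] (hM : Supports M S₀) (k₀ : K) (hks : ks.Nodup)
    (hk : ∀ k, k ∈ ks) (hc : c.l ∈ Finset.insertNone S₀) :
    (StateTransition.eval (step M) c).Dom ↔ ∃ n, (toStackMachine M S₀ k₀).toQueue.Consumes n
      (.search (c.toState M S₀)) (queue c.stk ks) := by
  have hstep {c c' : Cfg (fun _ : K => Γ) Λ σ} (hc : c.l ∈ Finset.insertNone S₀)
      (h : step M c = some c') : LeadsTo M S₀ k₀ ks (c.toState M S₀) c.stk c' := by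
    obtain ⟨_ | l, v, S⟩ := c
    · simp at h
    · obtain rfl : stepAux (M l) v S = c' := by simpa using h
      exact leadsTo_stepAux hks hk (stmt_mem_stmts (by simpa using hc))
  have hhalt {c : Cfg (fun _ : K => Γ) Λ σ} (h : step M c = none) :
      toStackMachine M S₀ k₀ (c.toState M S₀) = none := by
    obtain ⟨_ | l, v, S⟩ := c
    · rw [Cfg.toState, Option.map_none, toState_of_mem Finset.none_mem_insertNone]
      rfl
    · simp at h
  constructor
  · intro h
    have := Part.get_mem h
    revert hc
    refine StateTransition.evalInduction this fun c hb ih hc => ?_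
    cases hs : step M c with
    | none => exact exists_consumes_of_halt (hhalt hs) _ _
    | some c' =>
      obtain ⟨n, hn⟩ := ih c' hs (step_supports M hM hs hc)
      obtain ⟨d, -, H, -⟩ := hstep hc hs
      exact ⟨_, (H n).2 hn⟩
  · rintro ⟨n, hn⟩
    -- Each step of `M` uses up `d > 0` of the `n` rounds, so `M` must halt.
    induction n using Nat.strong_induction_on generalizing c with
    | _ n ih =>
      cases hs : step M c with
      | none => exact Part.dom_iff_mem.2 ⟨c, StateTransition.mem_eval.2 ⟨.refl, hs⟩⟩
      | some c' =>
        rw [StateTransition.reaches_eval (.single hs)]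
        obtain ⟨d, hd, H, H'⟩ := hstep hc hs
        obtain ⟨m, rfl⟩ := Nat.exists_eq_add_of_le' (not_lt.1 fun h => H' n h hn)
        exact ih m (by omega) (step_supports M hM hs hc) ((H m).1 hn)

end Turing.TM2

/-! ### Partial recursive functions as queue machines with unary input -/

theorem primrec_two_pow : Primrec fun x : ℕ => 2 ^ x := by
  refine (Primrec.nat_rec₁ (f := fun _ y => 2 * y) 1 ?_).of_eq fun x => ?_
  · exact Primrec.nat_mul.comp (Primrec.const 2) Primrec.snd
  · induction x with
    | zero => rfl
    | succ x ih => simp_all [pow_succ']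

/-- Binary exponents can be recovered by a partial recursive function. -/
theorem partrec_comp_log {f : ℕ →. ℕ} (hf : Partrec f) :
    ∃ g : ℕ →. ℕ, Partrec g ∧ ∀ x, g (2 ^ x) = f x := by
  refine ⟨fun y => (Nat.rfind fun x => Part.some (decide (2 ^ x = y))).bind f,
    .bind (Partrec.rfind ?_) (hf.comp Computable.snd), fun x => ?_⟩
  · have h : PrimrecPred fun p : ℕ × ℕ => 2 ^ p.2 = p.1 :=
      Primrec.eq.comp (primrec_two_pow.comp Primrec.snd) Primrec.fst
    exact h.decide.to_comp
  · have : (Nat.rfind fun x' => Part.some (decide (2 ^ x' = 2 ^ x))) = Part.some x := by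
      refine Part.eq_some_iff.2 (Nat.mem_rfind.2 ⟨by simp, fun {m} hm => ?_⟩)
      simpa using hm.ne
    exact (congrArg (Part.bind · f) this).trans (Part.bind_some _ _)

namespace Turing.PartrecToTM2

/-- Bits are stored least significant first. Feeding `2 ^ x` instead of `x` thus gives an initial
queue in which `x` appears only as the length of a block of equal letters. -/
theorem trNat_two_pow (x : ℕ) : trNat (2 ^ x) = List.replicate x Γ'.bit0 ++ [Γ'.bit1] := by
  have h : ((2 ^ x : ℕ) : Num) = Num.pos (PosNum.bit0^[x] .one) := by
    rw [← PosNum.of_to_nat]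
    congr 1
    induction x with
    | zero => rfl
    | succ x ih => rw [pow_succ', ih, Function.iterate_succ_apply', PosNum.cast_bit0, two_mul]
  rw [trNat, h, trNum]
  clear h
  induction x with
  | zero => rfl
  | succ x ih => rw [Function.iterate_succ_apply', trPosNum, ih]; rfl

open QueueMachine StackMachine in
/-- Every partial recursive function has a queue machine that halts on the queue standing for `x`
if and only if the function is defined at `x`. -/
theorem exists_queueMachine {f : ℕ →. ℕ} (hf : Partrec f) :
    ∃ (Q A : Type) (_ : Finite Q) (_ : Finite A) (δ : QueueMachine Q A) (q : Q) (a b : A)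
      (c : List A), ∀ x, (f x).Dom ↔ ∃ n, δ.Consumes n q (List.replicate x a ++ b :: c) := by
  obtain ⟨g, hg, hgf⟩ := partrec_comp_log hf
  obtain ⟨code, hcode⟩ := ToPartrec.Code.exists_code (Nat.Partrec'.part_iff₁.2 hg)
  let S₀ := codeSupp code .halt
  let l := trNormal code .halt
  let _ : Inhabited Λ' := ⟨l⟩
  have hM : TM2.Supports tr S₀ := tr_supports code .halt
  let ks : List K' := [.main, .rev, .aux, .stack]
  have hks : ks.Nodup := by decide
  have hk : ∀ k, k ∈ ks := by rintro (_ | _ | _ | _) <;> simp [ks]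
  have : Finite K' := Set.finite_univ_iff.1 (ks.finite_toSet.subset fun k _ => hk k)
  let M := TM2.toStackMachine tr S₀ .main
  let p : TM2.StackState tr S₀ := TM2.toState (some (tr l)) none
  have hc (v : List ℕ) : (init code v).toState tr S₀ = p := rfl
  let u : List (Letter K' Γ') := some (.inl .rev) :: some (.inl .aux) :: some (.inl .stack) :: []
  -- The queue of the initial stacks begins with the marker of `main`. Starting in the middle of a
  -- rotation, with that marker behind the end mark, lets the queue begin with the block of `bit0`.
  refine ⟨QueueState (TM2.StackState tr S₀), Letter K' Γ', inferInstance, inferInstance,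
    M.toQueue, .copy p, some (.inr .bit0), some (.inr .bit1),
    some (.inr .cons) :: (u ++ [none, some (.inl .main)]), fun x => ?_⟩
  have e₁ : (f x).Dom ↔ (StateTransition.eval (TM2.step tr) (init code [2 ^ x])).Dom := by
    rw [tr_eval, ← hgf]
    have := hcode ⟨[2 ^ x], rfl⟩
    simp only [List.Vector.head] at this
    rw [this]
    rfl
  have e₂ := TM2.eval_dom_iff_exists_consumes (c := init code [2 ^ x]) hM .main hks hk
    (Finset.some_mem_insertNone.2 hM.1)
  rw [e₁, e₂, hc]
  have hq : queue (init code [2 ^ x]).stk ks =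
      [some (.inl .main)] ++ ((List.replicate x (some (.inr .bit0)) ++
        some (.inr .bit1) :: some (.inr .cons) :: u)) ++ [none] := by
    simp [queue, blocks, ks, init, syms, trNat_two_pow, u]
  rw [hq]
  have H (n : ℕ) := consumes_copy_state (M := M) (p := p) (n := n) (v := [some (.inl .main)])
    (u := List.replicate x (some (.inr .bit0)) ++ some (.inr .bit1) :: some (.inr .cons) :: u)
    (by simp [u, List.mem_replicate])
  have e₃ : (List.replicate x (some (.inr .bit0)) ++ some (.inr .bit1) ::
      some (.inr .cons) :: (u ++ [none, some (.inl .main)]) : List (Letter K' Γ')) =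
      (List.replicate x (some (.inr .bit0)) ++ some (.inr .bit1) :: some (.inr .cons) :: u) ++
        none :: [some (.inl .main)] := by simp
  rw [e₃]
  constructor
  · rintro ⟨n, hn⟩
    exact ⟨_, (H n).2 hn⟩
  · rintro ⟨n, hn⟩
    obtain ⟨m, rfl⟩ := Nat.exists_eq_add_of_le' hn.length_le
    -- The extra round accounts for the marker of `main` behind the end mark, which the rotation
    -- does not remove.
    refine ⟨m + 1, (H (m + 1)).1 ?_⟩
    convert hn using 1
    simp only [List.length_append, List.length_cons, List.length_nil]
    omega

end Turing.PartrecToTM2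

/-! ### The one-turn automaton -/

namespace PowerAutomaton

/-- States of the automaton that reads `u $ y # u' $ y' # …`: `left` and `right` push `u $ y`,
`init j` and `run l q` compare `y` with the queue and what the queue machine appends to it while
reading `u'`, `compare` compares `u` with `y'`, and `tail k` counts the remaining blocks. -/
inductive State (Q A : Type*)
  | left
  | right
  | init (j : ℕ)
  | run (l : List A) (q : Q)
  | compare
  | tail (k : ℕ)

/-- What the automaton depends on, apart from the length of the initial queue: a queue machine `δ`
whose words have length at most `bound`, its initial state `q₀`, the initial queue
`a₀ ^ x ++ b₀ :: l₀`, the number `blocks` of blocks after the first two, and codes. -/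
structure Data (Q A : Type*) where
  δ : QueueMachine Q A
  q₀ : Q
  a₀ : A
  b₀ : A
  l₀ : List A
  blocks : ℕ
  bound : ℕ
  codeLetter : A ↪ ℕ
  codeRun : List A × Q ↪ ℕ
  length_le : ∀ {q f}, δ q = some f → ∀ a, (f a).1.length ≤ bound
  length_le₀ : l₀.length ≤ bound

variable {Q A : Type*} (D : Data Q A)

namespace Data

/-- The code of a letter. The codes `0` and `1` are used for the two separators. -/
def sym (a : A) : ℕ := D.codeLetter a + 2

/-- The code of a state. -/
def code : State Q A → ℕ
  | .left => 0
  | .right => 1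
  | .compare => 2
  | .run l q => 3 * D.codeRun (l, q) + 3
  | .tail k => 3 * k + 4
  | .init j => 3 * j + 5

@[simp]
theorem sym_inj {a b : A} : D.sym a = D.sym b ↔ a = b := by simp [sym]

@[simp]
theorem sym_ne_zero (a : A) : D.sym a ≠ 0 := by simp [sym]

@[simp]
theorem sym_ne_one (a : A) : D.sym a ≠ 1 := by simp [sym]

@[simp]
theorem zero_ne_sym (a : A) : 0 ≠ D.sym a := (D.sym_ne_zero a).symm

@[simp]
theorem one_ne_sym (a : A) : 1 ≠ D.sym a := (D.sym_ne_one a).symm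

theorem code_injective : Function.Injective D.code := by
  rintro (_ | _ | j | ⟨l, q⟩ | _ | k) (_ | _ | j' | ⟨l', q'⟩ | _ | k') h <;>
    simp only [code] at h <;> first | rfl | omega | skip
  · rw [show j = j' by omega]
  · have := D.codeRun.injective (show D.codeRun (l, q) = D.codeRun (l', q') by omega)
    simp_all
  · rw [show k = k' by omega]

@[simp]
theorem code_inj {s t : State Q A} : D.code s = D.code t ↔ s = t := D.code_injective.eq_iff

/-- The stack symbols, which are also the input letters. -/
def symbols : Set ℕ := {0, 1} ∪ Set.range D.sym

/-- The rules that do not depend on the length of the initial queue. -/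
inductive StaticRule : PDARule → Prop
  | left (a : A) {X : ℕ} : X ∈ D.symbols →
    StaticRule ⟨D.code .left, some (D.sym a), X, D.code .left, [D.sym a, X]⟩
  | mid {X : ℕ} : X ∈ D.symbols → StaticRule ⟨D.code .left, some 0, X, D.code .right, [0, X]⟩
  | right (a : A) {X : ℕ} : X ∈ D.symbols →
    StaticRule ⟨D.code .right, some (D.sym a), X, D.code .right, [D.sym a, X]⟩
  | enter {X : ℕ} : X ∈ D.symbols → StaticRule ⟨D.code .right, some 1, X, D.code (.init 0), [X]⟩
  | write (b : A) {l : List A} (q : Q) : (b :: l).length ≤ D.bound →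
    StaticRule ⟨D.code (.run (b :: l) q), none, D.sym b, D.code (.run l q), []⟩
  | read {q : Q} {f : A → List A × Q} (a : A) {X : ℕ} : D.δ q = some f → X ∈ D.symbols →
    StaticRule ⟨D.code (.run [] q), some (D.sym a), X, D.code (.run (f a).1 (f a).2), [X]⟩
  | halt {q : Q} : D.δ q = none → StaticRule ⟨D.code (.run [] q), some 0, 0, D.code .compare, []⟩
  | compare (a : A) :
    StaticRule ⟨D.code .compare, some (D.sym a), D.sym a, D.code .compare, []⟩
  | done : StaticRule ⟨D.code .compare, some 1, 1, D.code (.tail 0), [1]⟩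
  | skip {k i : ℕ} : k < D.blocks → i ∈ D.symbols → i ≠ 1 →
    StaticRule ⟨D.code (.tail k), some i, 1, D.code (.tail k), [1]⟩
  | next {k : ℕ} : k < D.blocks →
    StaticRule ⟨D.code (.tail k), some 1, 1, D.code (.tail (k + 1)), [1]⟩

/-- The rules for the initial queue `a₀ ^ x ++ b₀ :: l₀`. -/
inductive Rule (x : ℕ) : PDARule → Prop
  | static {r : PDARule} : D.StaticRule r → Rule x r
  | init {j : ℕ} : j < x →
    Rule x ⟨D.code (.init j), none, D.sym D.a₀, D.code (.init (j + 1)), []⟩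
  | last : Rule x ⟨D.code (.init x), none, D.sym D.b₀, D.code (.run D.l₀ D.q₀), []⟩

theorem finite_symbols [Finite A] : D.symbols.Finite :=
  (Set.toFinite _).union (Set.finite_range _)

/-- States `run l q` only occur with `l` a suffix of `l₀` or of a word written by `δ`; `bound`
leaves finitely many such `l`. -/
theorem finite_staticRule [Finite A] [Finite Q] : {r | D.StaticRule r}.Finite := by
  let S : Set ℕ := D.code '' ({.left, .right, .compare, .init 0} ∪
    (fun p : List A × Q => State.run p.1 p.2) '' ({l | l.length ≤ D.bound} ×ˢ Set.univ) ∪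
    State.tail '' Set.Iic D.blocks)
  have hS : S.Finite := (((Set.toFinite _).union
    (((List.finite_length_le A D.bound).prod Set.finite_univ).image _)).union
    ((Set.finite_Iic _).image _)).image _
  let P : Set (List ℕ) := {[]} ∪ (fun X => [X]) '' D.symbols ∪
    Set.image2 (fun X Y => [X, Y]) D.symbols D.symbols
  have hP : P.Finite := ((Set.toFinite _).union (D.finite_symbols.image _)).union
    (D.finite_symbols.image2 _ D.finite_symbols)
  have hI : ({none} ∪ some '' D.symbols : Set (Option ℕ)).Finite :=
    (Set.toFinite _).union (D.finite_symbols.image _)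
  refine ((hS.prod (hI.prod (D.finite_symbols.prod (hS.prod hP)))).preimage
    PDARule.equivTuple.injective.injOn).subset ?_
  have h0 : 0 ∈ D.symbols := by simp [symbols]
  have h1 : 1 ∈ D.symbols := by simp [symbols]
  have ha (a : A) : D.sym a ∈ D.symbols := by simp [symbols]
  have hrun {l : List A} (hl : l.length ≤ D.bound) (q : Q) : D.code (.run l q) ∈ S :=
    ⟨_, .inl (.inr ⟨(l, q), ⟨hl, trivial⟩, rfl⟩), rfl⟩
  have htail {k : ℕ} (hk : k ≤ D.blocks) : D.code (.tail k) ∈ S :=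
    ⟨_, .inr ⟨k, hk, rfl⟩, rfl⟩
  have hleft : D.code .left ∈ S := ⟨_, .inl (.inl (by simp)), rfl⟩
  have hright : D.code .right ∈ S := ⟨_, .inl (.inl (by simp)), rfl⟩
  have hcompare : D.code .compare ∈ S := ⟨_, .inl (.inl (by simp)), rfl⟩
  have hinit : D.code (.init 0) ∈ S := ⟨_, .inl (.inl (by simp)), rfl⟩
  have hi {i : ℕ} (h : i ∈ D.symbols) : some i ∈ ({none} ∪ some '' D.symbols : Set (Option ℕ)) :=
    .inr ⟨i, h, rfl⟩
  have hp1 {X : ℕ} (h : X ∈ D.symbols) : [X] ∈ P := .inl (.inr ⟨X, h, rfl⟩)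
  have hp2 {X Y : ℕ} (h : X ∈ D.symbols) (h' : Y ∈ D.symbols) : [X, Y] ∈ P :=
    .inr ⟨X, h, Y, h', rfl⟩
  have hp0 : [] ∈ P := .inl (.inl rfl)
  rintro r hr
  cases hr with
  | left a h => exact ⟨hleft, hi (ha a), h, hleft, hp2 (ha a) h⟩
  | mid h => exact ⟨hleft, hi h0, h, hright, hp2 h0 h⟩
  | right a h => exact ⟨hright, hi (ha a), h, hright, hp2 (ha a) h⟩
  | enter h => exact ⟨hright, hi h1, h, hinit, hp1 h⟩
  | write b q h => exact ⟨hrun h q, .inl rfl, ha b, hrun (Nat.le_of_succ_le h) q, hp0⟩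
  | read a hf h => exact ⟨hrun (Nat.zero_le _) _, hi (ha a), h, hrun (D.length_le hf a) _, hp1 h⟩
  | halt => exact ⟨hrun (Nat.zero_le _) _, hi h0, h0, hcompare, hp0⟩
  | compare a => exact ⟨hcompare, hi (ha a), ha a, hcompare, hp0⟩
  | done => exact ⟨hcompare, hi h1, h1, htail (Nat.zero_le _), hp1 h1⟩
  | skip hk h => exact ⟨htail hk.le, hi h, h1, htail hk.le, hp1 h1⟩
  | next hk => exact ⟨htail hk.le, hi h1, h1, htail hk, hp1 h1⟩

/-- The rules that do not depend on the length of the initial queue, as a list. -/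
noncomputable def staticRules [Finite A] [Finite Q] : List PDARule :=
  D.finite_staticRule.toFinset.toList

/-- The automaton for the initial queue `a₀ ^ x ++ b₀ :: l₀`. -/
noncomputable def pda [Finite A] [Finite Q] (x : ℕ) : PDA where
  rules := D.staticRules ++
    ⟨3 * x + 5, none, D.sym D.b₀, D.code (.run D.l₀ D.q₀), []⟩ ::
    (List.range x).map fun j => ⟨3 * j + 5, none, D.sym D.a₀, 3 * j + 8, []⟩
  start := 0
  -- The separator 1 also marks the bottom of the stack, so `done` compares it with the 1 that
  -- follows `y'`.
  bottom := 1
  final := [3 * D.blocks + 4]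

variable [Finite A] [Finite Q] {D}

theorem mem_rules {x : ℕ} {r : PDARule} : r ∈ (D.pda x).rules ↔ D.Rule x r := by
  simp only [pda, staticRules, List.mem_append, Finset.mem_toList, Set.Finite.mem_toFinset,
    Set.mem_ofPred_eq, List.mem_cons, List.mem_map, List.mem_range]
  constructor
  · rintro (h | rfl | ⟨j, hj, rfl⟩)
    · exact .static h
    · exact .last
    · exact .init hj
  · rintro (h | hj | _)
    · exact .inl h
    · exact .inr (.inr ⟨_, hj, rfl⟩)
    · exact .inr (.inl rfl)

theorem isDeterministic (x : ℕ) : (D.pda x).IsDeterministic := by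
  intro r hr s hs h₁ h₂ h₃
  rw [mem_rules] at hr hs
  rcases hr with hr | hr | _ <;> [cases hr; skip; skip] <;>
    (rcases hs with hs | hs | _ <;> [cases hs; skip; skip] <;> simp_all)

/-- The codes 0 and 1 belong to the pushing states `left` and `right`, whose rules never shorten the
stack. The states with codes at least 2 are never left again and their rules never lengthen it. -/
theorem isOneTurn (x : ℕ) : (D.pda x).IsOneTurn := by
  have hpush {r : PDARule} (hr : D.Rule x r) (h : r.source < 2) : 1 ≤ r.push.length := by
    rcases hr with hr | hr | _ <;> [cases hr; skip; skip] <;> simp_all [code]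
  have hpop {r : PDARule} (hr : D.Rule x r) (h : 2 ≤ r.source) :
      2 ≤ r.target ∧ r.push.length ≤ 1 := by
    rcases hr with hr | hr | _ <;> [cases hr; skip; skip] <;> simp_all [code]
  intro w c₁ c₂ c₃ c₄ _ h₁₂ h₂₃ h₃₄ hlt
  have h₂ : 2 ≤ c₂.state := by
    obtain ⟨r, hr, v, γ⟩ := h₁₂
    rw [mem_rules] at hr
    by_contra! h
    have : r.source < 2 := by
      by_contra! h'
      exact absurd (hpop hr h').1 (by simpa using h)
    have := hpush hr this
    simp only [List.length_append, List.length_cons] at hlt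
    omega
  have h₃ {c : PDAConfig} (h : (D.pda x).Reaches c₂ c) : 2 ≤ c.state := by
    induction h with
    | refl => exact h₂
    | tail _ h ih =>
      obtain ⟨r, hr, v, γ⟩ := h
      exact (hpop (mem_rules.1 hr) ih).1
  replace h₃ := h₃ h₂₃
  obtain ⟨r, hr, v, γ⟩ := h₃₄
  have := (hpop (mem_rules.1 hr) h₃).2
  simp only [List.length_append, List.length_cons]
  omega

end Data

end PowerAutomaton

/-! ### The accepted words -/

theorem List.eq_and_eq_of_append_cons_eq {α : Type*} {a : α} {u u' v v' : List α} (hu : a ∉ u)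
    (hu' : a ∉ u') (h : u ++ a :: v = u' ++ a :: v') : u = u' ∧ v = v' := by
  induction u generalizing u' with
  | nil =>
    cases u' with
    | nil => simpa using h
    | cons b u' =>
      rw [List.nil_append, List.cons_append, List.cons.injEq] at h
      exact absurd (h.1 ▸ List.mem_cons_self) hu'
  | cons b u ih =>
    cases u' with
    | nil =>
      rw [List.nil_append, List.cons_append, List.cons.injEq] at h
      exact absurd (h.1 ▸ List.mem_cons_self) hu
    | cons b' u' =>
      simp only [List.cons_append, List.cons.injEq, List.mem_cons, not_or] at h hu hu'
      obtain ⟨rfl, rfl⟩ := ih hu.2 hu'.2 h.2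
      simp [h.1]

namespace PowerAutomaton

variable {Q A : Type*} (D : Data Q A)

namespace Data

/-- A word of the queue machine as a word of the automaton. -/
abbrev syms (l : List A) : List ℕ := l.map D.sym

/-- The remaining input `v` is accepted from the state `tail k`. -/
def TailInput (k : ℕ) (v : List ℕ) : Prop :=
  k + v.count 1 = D.blocks ∧ (v = [] ∨ v.getLast? = some 1)

/-- The remaining input `v` is accepted from the state `compare`, with stack `γ`. -/
def CompareInput (v γ : List ℕ) : Prop :=
  ∃ y v' γ', v = D.syms y ++ 1 :: v' ∧ γ = D.syms y ++ 1 :: γ' ∧ D.TailInput 0 v'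

/-- The remaining input `v` is accepted from the state `run l q`, with stack `γ`. -/
def RunInput (l : List A) (q : Q) (v γ : List ℕ) : Prop :=
  ∃ u z v' γ', D.δ.Transduces q u z ∧ v = D.syms u ++ 0 :: v' ∧ γ = D.syms (l ++ z) ++ 0 :: γ' ∧
    D.CompareInput v' γ'

/-- The initial queue. -/
def initQueue (x : ℕ) : List A := List.replicate x D.a₀ ++ D.b₀ :: D.l₀

/-- The remaining input `v` is accepted from the state `right`, with stack `γ`. -/
def RightInput (x : ℕ) (v γ : List ℕ) : Prop :=
  ∃ y v', v = D.syms y ++ 1 :: v' ∧ D.RunInput (D.initQueue x) D.q₀ v' (D.syms y.reverse ++ γ)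

/-- The remaining input `v` is accepted from the state `s`, with stack `γ`. -/
def Input (x : ℕ) : State Q A → List ℕ → List ℕ → Prop
  | .left, v, γ => ∃ u v', v = D.syms u ++ 0 :: v' ∧ D.RightInput x v' (0 :: D.syms u.reverse ++ γ)
  | .right, v, γ => D.RightInput x v γ
  | .init j, v, γ => j ≤ x ∧ D.RunInput (D.initQueue (x - j)) D.q₀ v γ
  | .run l q, v, γ => D.RunInput l q v γ
  | .compare, v, γ => D.CompareInput v γ
  | .tail k, v, _ => D.TailInput k v

variable {D}

theorem TailInput.cons {k i : ℕ} {v : List ℕ} (hk : k < D.blocks) (hi : i ≠ 1)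
    (h : D.TailInput k v) : D.TailInput k (i :: v) := by
  obtain ⟨hc, h⟩ := h
  refine ⟨by rwa [List.count_cons_of_ne hi], .inr ?_⟩
  rcases h with rfl | h
  · simp at hc
    omega
  · simp [List.getLast?_cons, h]

theorem TailInput.cons_one {k : ℕ} {v : List ℕ} (h : D.TailInput (k + 1) v) :
    D.TailInput k (1 :: v) := by
  obtain ⟨hc, h⟩ := h
  refine ⟨by rw [List.count_cons_self]; omega, .inr ?_⟩
  rcases h with rfl | h
  · rfl
  · simp [List.getLast?_cons, h]

/-- `Input` is an invariant to be carried backwards along a computation, from the final state, where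
it holds trivially, to the initial configuration. -/
theorem Rule.exists_states {x : ℕ} {r : PDARule} (hr : D.Rule x r) :
    ∃ s t : State Q A, r.source = D.code s ∧ r.target = D.code t ∧
      ∀ v γ, D.Input x t v (r.push ++ γ) → D.Input x s (r.input.toList ++ v) (r.pop :: γ) := by
  rcases hr with hr | @⟨j, hj⟩ | _
  · cases hr with
    | left a =>
      refine ⟨.left, .left, rfl, rfl, ?_⟩
      rintro _ γ ⟨u, v', rfl, h⟩
      exact ⟨a :: u, v', by simp, by simpa using h⟩
    | mid =>
      refine ⟨.left, .right, rfl, rfl, fun v γ h => ?_⟩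
      exact ⟨[], v, by simp, by simpa [Input] using h⟩
    | right a =>
      refine ⟨.right, .right, rfl, rfl, ?_⟩
      rintro _ γ ⟨u, v', rfl, h⟩
      exact ⟨a :: u, v', by simp, by simpa using h⟩
    | enter =>
      refine ⟨.right, .init 0, rfl, rfl, fun v γ h => ?_⟩
      exact ⟨[], v, by simp, by simpa using h.2⟩
    | @write b l q =>
      refine ⟨.run (b :: l) q, .run l q, rfl, rfl, ?_⟩
      rintro _ γ ⟨u, z, v', γ', hu, rfl, e, h⟩
      exact ⟨u, z, v', γ', hu, rfl, by simpa using e, h⟩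
    | @read q f a X hf =>
      refine ⟨.run [] q, .run (f a).1 (f a).2, rfl, rfl, ?_⟩
      rintro _ γ ⟨u, z, v', γ', hu, rfl, e, h⟩
      exact ⟨a :: u, _, v', γ', .read hf hu, by simp, by simpa using e, h⟩
    | @halt q hq =>
      refine ⟨.run [] q, .compare, rfl, rfl, fun v γ h => ?_⟩
      exact ⟨[], [], v, γ, .halt hq, by simp, by simp, h⟩
    | compare a =>
      refine ⟨.compare, .compare, rfl, rfl, ?_⟩
      rintro _ γ ⟨y, v', γ', rfl, e, h⟩
      exact ⟨a :: y, v', γ', by simp, by simpa using e, h⟩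
    | done =>
      refine ⟨.compare, .tail 0, rfl, rfl, fun v γ h => ?_⟩
      exact ⟨[], v, γ, by simp, by simp, h⟩
    | @skip k i hk _ hi =>
      exact ⟨.tail k, .tail k, rfl, rfl, fun v γ h => TailInput.cons hk hi h⟩
    | @next k hk =>
      exact ⟨.tail k, .tail (k + 1), rfl, rfl, fun v γ h => TailInput.cons_one h⟩
  · refine ⟨.init j, .init (j + 1), rfl, rfl, ?_⟩
    rintro _ γ ⟨-, u, z, v', γ', hu, rfl, e, h⟩
    refine ⟨hj.le, u, z, v', γ', hu, rfl, ?_, h⟩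
    rw [show x - j = x - (j + 1) + 1 by omega]
    simpa [initQueue, List.replicate_succ] using e
  · refine ⟨.init x, .run D.l₀ D.q₀, rfl, rfl, ?_⟩
    rintro _ γ ⟨u, z, v', γ', hu, rfl, e, h⟩
    refine ⟨le_rfl, u, z, v', γ', hu, rfl, ?_, h⟩
    simpa [initQueue] using e

/-- Even a rule that leaves the stack alone has to name its top symbol. -/
theorem symbols_head {u : List A} {i : ℕ} (hi : i ∈ D.symbols) {γ : List ℕ} :
    ∃ X γ', D.syms u ++ i :: γ = X :: γ' ∧ X ∈ D.symbols := by
  cases u with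
  | nil => exact ⟨_, _, rfl, hi⟩
  | cons a u => exact ⟨_, _, rfl, .inr ⟨a, rfl⟩⟩

theorem zero_mem_symbols : 0 ∈ D.symbols := .inl (.inl rfl)

theorem one_mem_symbols : 1 ∈ D.symbols := .inl (.inr rfl)

theorem sym_mem_symbols (a : A) : D.sym a ∈ D.symbols := .inr ⟨a, rfl⟩

variable [Finite A] [Finite Q]

theorem input_of_mem_language {x : ℕ} {w : List ℕ} (hw : w ∈ (D.pda x).language) :
    D.Input x .left w [1] := by
  obtain ⟨p, hp, γ, h⟩ := hw
  have key : ∀ c, (D.pda x).Reaches c ⟨p, [], γ⟩ →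
      ∃ s, c.state = D.code s ∧ D.Input x s c.input c.stack := by
    intro c h
    induction h using Relation.ReflTransGen.head_induction_on with
    | refl =>
      refine ⟨.tail D.blocks, List.mem_singleton.1 hp, ?_, .inl rfl⟩
      simp
    | head h _ ih =>
      obtain ⟨r, hr, v, γ⟩ := h
      obtain ⟨t, ht, ih⟩ := ih
      obtain ⟨s, t', hs, ht', H⟩ := (mem_rules.1 hr).exists_states
      obtain rfl := D.code_injective (ht'.symm.trans ht)
      exact ⟨s, hs, H _ _ ih⟩
  obtain ⟨s, hs, h⟩ := key _ h
  obtain rfl := D.code_injective (show D.code .left = D.code s from hs)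
  exact h

/-- The automaton accepts when started in state `s` with input `v` and stack `γ`. -/
def Accepts (D : Data Q A) (x : ℕ) (s : State Q A) (v γ : List ℕ) : Prop :=
  ∃ γ', (D.pda x).Reaches ⟨D.code s, v, γ⟩ ⟨D.code (.tail D.blocks), [], γ'⟩

theorem Accepts.of_rule {x : ℕ} {r : PDARule} (hr : D.Rule x r) {s t : State Q A}
    (hs : r.source = D.code s) (ht : r.target = D.code t) {v γ : List ℕ}
    (h : D.Accepts x t v (r.push ++ γ)) : D.Accepts x s (r.input.toList ++ v) (r.pop :: γ) := by
  obtain ⟨γ', h⟩ := h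
  refine ⟨γ', .head ?_ h⟩
  rw [← hs, ← ht]
  exact .apply r (mem_rules.2 hr) v γ

theorem Accepts.of_static {x : ℕ} {s t : State Q A} {i : Option ℕ} {X : ℕ} {push v γ : List ℕ}
    (h : D.Accepts x t v (push ++ γ)) (hr : D.StaticRule ⟨D.code s, i, X, D.code t, push⟩) :
    D.Accepts x s (i.toList ++ v) (X :: γ) :=
  .of_rule (.static hr) rfl rfl h

theorem accepts_tail {x k : ℕ} {v γ : List ℕ} (hv : ∀ i ∈ v, i ∈ D.symbols ∧ i ≠ 1)
    (hk : k ≤ D.blocks) : D.Accepts x (.tail (D.blocks - k))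
      (List.replicate k (v ++ [1])).flatten (1 :: γ) := by
  induction k with
  | zero => exact ⟨_, .refl⟩
  | succ k ih =>
    have hlt : D.blocks - (k + 1) < D.blocks := by omega
    rw [List.replicate_succ, List.flatten_cons, List.append_assoc]
    generalize (List.replicate k (v ++ [1])).flatten = t at ih
    replace ih := ih (Nat.le_of_succ_le hk)
    induction v with
    | nil =>
      refine Accepts.of_static (i := some 1) ?_ (.next hlt)
      rw [show D.blocks - (k + 1) + 1 = D.blocks - k by omega]
      exact ih
    | cons i v ihv =>
      refine Accepts.of_static (i := some i) ?_
        (.skip hlt (hv i List.mem_cons_self).1 (hv i List.mem_cons_self).2)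
      exact ihv (fun i hi => hv i (List.mem_cons_of_mem _ hi))

theorem accepts_compare {x : ℕ} {y : List A} {v γ : List ℕ}
    (h : D.Accepts x (.tail 0) v (1 :: γ)) :
    D.Accepts x .compare (D.syms y ++ 1 :: v) (D.syms y ++ 1 :: γ) := by
  induction y with
  | nil => exact Accepts.of_static (i := some 1) h .done
  | cons a y ih => exact Accepts.of_static (i := some _) (push := []) ih (.compare a)

theorem accepts_write {x : ℕ} {l : List A} (hl : l.length ≤ D.bound) {q : Q} {v γ : List ℕ}
    (h : D.Accepts x (.run [] q) v γ) : D.Accepts x (.run l q) v (D.syms l ++ γ) := by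
  induction l with
  | nil => exact h
  | cons b l ih =>
    exact Accepts.of_static (i := none) (push := []) (ih (Nat.le_of_succ_le hl)) (.write b q hl)

theorem accepts_run {x : ℕ} {q : Q} {u z : List A} (ht : D.δ.Transduces q u z) {v γ : List ℕ}
    (h : D.Accepts x .compare v γ) :
    D.Accepts x (.run [] q) (D.syms u ++ 0 :: v) (D.syms z ++ 0 :: γ) := by
  induction ht with
  | halt hq => exact Accepts.of_static (i := some 0) (push := []) h (.halt hq)
  | read hf _ ih =>
    rename_i f a x z _
    have := accepts_write (D.length_le hf a) ih
    rw [← List.append_assoc, ← List.map_append] at this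
    obtain ⟨X, γ', e, hX⟩ := symbols_head (u := (f a).1 ++ z) (zero_mem_symbols (D := D)) (γ := γ)
    rw [e] at this ⊢
    exact Accepts.of_static (i := some _) (push := [X]) this (.read a hf hX)

theorem accepts_init {x : ℕ} {v γ : List ℕ} (h : D.Accepts x (.run [] D.q₀) v γ) :
    D.Accepts x (.init 0) v (D.syms (D.initQueue x) ++ γ) := by
  have key (k : ℕ) (hk : k ≤ x) :
      D.Accepts x (.init (x - k)) v (D.syms (D.initQueue k) ++ γ) := by
    induction k with
    | zero =>
      refine Accepts.of_rule (s := .init x) (t := .run D.l₀ D.q₀) (.last (x := x)) rfl rfl ?_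
      exact accepts_write D.length_le₀ h
    | succ k ih =>
      refine Accepts.of_rule (.init (j := x - (k + 1)) (by omega)) rfl
        (t := .init (x - (k + 1) + 1)) rfl ?_
      rw [show x - (k + 1) + 1 = x - k by omega]
      exact ih (Nat.le_of_succ_le hk)
  simpa using key x le_rfl

theorem accepts_right {x : ℕ} {y : List A} {v γ : List ℕ} {i : ℕ} (hi : i ∈ D.symbols)
    (h : D.Accepts x (.init 0) v (D.syms y.reverse ++ i :: γ)) :
    D.Accepts x .right (D.syms y ++ 1 :: v) (i :: γ) := by
  induction y generalizing i γ with
  | nil => exact Accepts.of_static (i := some 1) (push := [i]) h (.enter hi)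
  | cons a y ih =>
    refine Accepts.of_static (i := some _) (push := [D.sym a, i])
      (ih (sym_mem_symbols a) ?_) (.right a hi)
    simpa using h

theorem accepts_left {x : ℕ} {y : List A} {v γ : List ℕ} {i : ℕ} (hi : i ∈ D.symbols)
    (h : D.Accepts x .right v (0 :: D.syms y.reverse ++ i :: γ)) :
    D.Accepts x .left (D.syms y ++ 0 :: v) (i :: γ) := by
  induction y generalizing i γ with
  | nil => exact Accepts.of_static (i := some 0) (push := [0, i]) h (.mid hi)
  | cons a y ih =>
    refine Accepts.of_static (i := some _) (push := [D.sym a, i])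
      (ih (sym_mem_symbols a) ?_) (.left a hi)
    simpa using h

theorem exists_power_mem_language_iff (x : ℕ) :
    (∃ w : List ℕ, w ≠ [] ∧ wordPow w (D.blocks + 2) ∈ (D.pda x).language) ↔
      ∃ n, D.δ.Consumes n D.q₀ (D.initQueue x) := by
  have h0 (l : List A) : 0 ∉ D.syms l := by simp
  have h1 (l : List A) : 1 ∉ D.syms l := by simp
  constructor
  · rintro ⟨w, -, hw⟩
    obtain ⟨u, _, e, y, _, rfl, u', z, _, γ, hu', rfl, e', y', v, γ', rfl, e'', hv⟩ :=
      input_of_mem_language hw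
    -- The power has `D.blocks + 2` ones in all: the two displayed separators and those of `v`.
    have hcount : w.count 1 = 1 := by
      have hc := congrArg (List.count 1) e
      simp only [wordPow, List.count_flatten, List.map_replicate, List.sum_replicate,
        List.count_append, List.count_cons, List.count_eq_zero.2 (h1 _), smul_eq_mul] at hc
      norm_num at hc
      have := hv.1
      exact Nat.eq_of_mul_eq_mul_left (show 0 < D.blocks + 2 by omega) (by omega)
    have hlast : w.getLast? = some 1 := by
      have hl : (wordPow w (D.blocks + 2)).getLast? = some 1 := by
        rw [e]
        rcases hv.2 with rfl | hv
        · simp [List.getLast?_append, List.getLast?_cons]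
        · simp [List.getLast?_append, List.getLast?_cons, hv]
      have hw0 : w ≠ [] := by
        rintro rfl
        simp at hcount
      rw [wordPow, List.replicate_succ', List.flatten_append, List.getLast?_append] at hl
      cases h : w.getLast? with
      | none => exact absurd (List.getLast?_eq_none_iff.1 h) hw0
      | some i => simpa [h] using hl
    obtain ⟨t, rfl⟩ := List.getLast?_eq_some_iff.1 hlast
    have ht : 1 ∉ t := by
      rw [List.count_append] at hcount
      exact List.count_eq_zero.1 (by simpa using hcount)
    have e₁ : t ++ 1 :: (t ++ 1 :: wordPow (t ++ [1]) D.blocks) =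
        (D.syms u ++ 0 :: D.syms y) ++ 1 :: ((D.syms u' ++ 0 :: D.syms y') ++ 1 :: v) := by
      simpa [wordPow, List.replicate_succ] using e
    -- As `w` contains a single 1, at its end, the ones cut the power into copies of `w`; the zeros
    -- then identify `u` with `u'` and `y` with `y'`.
    obtain ⟨rfl, e₂⟩ := List.eq_and_eq_of_append_cons_eq ht (by simp) e₁
    obtain ⟨e₂, -⟩ := List.eq_and_eq_of_append_cons_eq ht (by simp) e₂
    obtain ⟨e₃, e₄⟩ := List.eq_and_eq_of_append_cons_eq (h0 _) (h0 _) e₂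
    have hinj := List.map_injective_iff.2 fun a b => (D.sym_inj (a := a) (b := b)).1
    obtain rfl := hinj e₃
    obtain rfl := hinj e₄
    rw [List.cons_append] at e'
    obtain ⟨e₅, rfl⟩ := List.eq_and_eq_of_append_cons_eq (h0 _) (h0 _) e'
    obtain ⟨e₆, -⟩ := List.eq_and_eq_of_append_cons_eq (h1 _) (h1 _) e''
    refine ⟨_, u, z, rfl, hu', ?_⟩
    rw [← hinj e₅, ← hinj e₆, List.reverse_reverse]
  · rintro ⟨n, u, z, -, hu, e⟩
    -- Taking `y` as `u` reversed meets the second comparison, and the first becomes `u = c ++ z`.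
    refine ⟨(D.syms u ++ 0 :: D.syms u.reverse) ++ [1], by simp, ?_⟩
    have hinit {v γ : List ℕ} (h : D.Accepts x .compare v γ) :
        D.Accepts x (.init 0) (D.syms u ++ 0 :: v) (D.syms u ++ 0 :: γ) := by
      have := accepts_init (accepts_run hu h)
      rwa [← List.append_assoc, ← List.map_append, ← e] at this
    have h : D.Accepts x .left (D.syms u ++ 0 :: (D.syms u.reverse ++ 1 :: (D.syms u ++ 0 ::
        (D.syms u.reverse ++ 1 :: (List.replicate D.blocks
          ((D.syms u ++ 0 :: D.syms u.reverse) ++ [1])).flatten)))) [1] := by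
      refine accepts_left one_mem_symbols (accepts_right zero_mem_symbols ?_)
      rw [List.reverse_reverse]
      refine hinit (accepts_compare ?_)
      have := accepts_tail (D := D) (x := x) (v := D.syms u ++ 0 :: D.syms u.reverse) (γ := [])
        (by
          intro i hi
          simp only [List.mem_append, List.mem_cons, List.mem_map] at hi
          rcases hi with ⟨a, -, rfl⟩ | rfl | ⟨a, -, rfl⟩
          · exact ⟨sym_mem_symbols a, D.sym_ne_one a⟩
          · exact ⟨zero_mem_symbols, zero_ne_one⟩
          · exact ⟨sym_mem_symbols a, D.sym_ne_one a⟩) (le_refl D.blocks)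
      rwa [Nat.sub_self] at this
    obtain ⟨γ, h⟩ := h
    refine ⟨_, List.mem_singleton_self _, γ, ?_⟩
    convert h using 1
    · simp [PDA.init, pda, code, wordPow, List.replicate_succ]
    · rfl

end Data

end PowerAutomaton

/-! ### Computability of the family and the reduction -/

theorem PDARule.primrec_mk {α : Type*} [Primcodable α] {s p t : α → ℕ} {i : α → Option ℕ}
    {w : α → List ℕ} (hs : Primrec s) (hi : Primrec i) (hp : Primrec p) (ht : Primrec t)
    (hw : Primrec w) : Primrec fun a => PDARule.mk (s a) (i a) (p a) (t a) (w a) :=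
  (Primrec.of_equiv_symm (e := PDARule.equivTuple)).comp
    (hs.pair (hi.pair (hp.pair (ht.pair hw))))

theorem PDA.primrec_mk {α : Type*} [Primcodable α] {r : α → List PDARule} {s b : α → ℕ}
    {w : α → List ℕ} (hr : Primrec r) (hs : Primrec s) (hb : Primrec b) (hw : Primrec w) :
    Primrec fun a => PDA.mk (r a) (s a) (b a) (w a) :=
  (Primrec.of_equiv_symm (e := PDA.equivTuple)).comp (hr.pair (hs.pair (hb.pair hw)))

/-- For fixed `D` the list `staticRules` is a constant, so its nonconstructive choice is harmless;
only the counter rules vary with `x`. -/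
theorem PowerAutomaton.Data.primrec_pda {Q A : Type*} [Finite A] [Finite Q] (D : Data Q A) :
    Primrec D.pda := by
  have lin (k : ℕ) : Primrec fun x : ℕ => 3 * x + k :=
    Primrec.nat_add.comp (Primrec.nat_mul.comp (.const 3) .id) (.const k)
  refine PDA.primrec_mk (Primrec.list_append.comp (.const _) (Primrec.list_cons.comp ?_
    (Primrec.list_map Primrec.list_range ?_))) (.const _) (.const _) (.const _)
  · exact PDARule.primrec_mk (lin 5) (.const _) (.const _) (.const _) (.const _)
  · exact PDARule.primrec_mk ((lin 5).comp .snd) (.const _) (.const _) ((lin 8).comp .snd)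
      (.const _)

open PowerAutomaton in
/-- The halting problem for a partial recursive function, in terms of powers in the languages of a
primitive recursive family of deterministic linear automata. -/
theorem exists_pda_family {n : ℕ} (hn : 2 ≤ n) {f : ℕ →. ℕ} (hf : Partrec f) :
    ∃ M : ℕ → PDA, Primrec M ∧ ∀ x, (M x).IsDeterministicLinear ∧
      ((∃ w : List ℕ, w ≠ [] ∧ wordPow w n ∈ (M x).language) ↔ (f x).Dom) := by
  obtain ⟨Q, A, _, _, δ, q, a, b, c, h⟩ := Turing.PartrecToTM2.exists_queueMachine hf
  obtain ⟨N, hN⟩ : ∃ N, ∀ q f, δ q = some f → ∀ a, (f a).1.length ≤ N := by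
    obtain ⟨N, hN⟩ := (Set.finite_range fun p : Q × A =>
      ((δ p.1).map fun f => (f p.2).1.length).getD 0).bddAbove
    refine ⟨N, fun q f hf a => ?_⟩
    simpa [hf] using hN ⟨(q, a), rfl⟩
  obtain ⟨eA⟩ := nonempty_embedding_nat A
  obtain ⟨eR⟩ := nonempty_embedding_nat (List A × Q)
  let D : Data Q A :=
    { δ := δ, q₀ := q, a₀ := a, b₀ := b, l₀ := c, blocks := n - 2, bound := max N c.length
      codeLetter := eA, codeRun := eR
      length_le := fun h a => (hN _ _ h a).trans (le_max_left _ _)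
      length_le₀ := le_max_right _ _ }
  refine ⟨D.pda, D.primrec_pda, fun x => ⟨⟨D.isDeterministic x, D.isOneTurn x⟩, ?_⟩⟩
  rw [h x, ← Nat.sub_add_cancel hn]
  exact D.exists_power_mem_language_iff x

theorem theorem4p4 (n : ℕ) (hn : 2 ≤ n) :
    ¬ DecidableOn PDA.IsDeterministicLinear
      (fun M : PDA => ∃ w : List ℕ, w ≠ [] ∧ wordPow w n ∈ M.language) := by
  rintro ⟨d, hd, H⟩
  -- A single universal function suffices: `x` codes a program, which is run on input 0.
  have hf : Partrec fun x : ℕ => (Denumerable.ofNat Nat.Partrec.Code x).eval 0 :=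
    Nat.Partrec.Code.eval_part.comp (Computable.ofNat _) (Computable.const 0)
  obtain ⟨M, hM, hMf⟩ := exists_pda_family hn hf
  classical
  refine ComputablePred.halting_problem 0 (ComputablePred.computable_iff.2
    ⟨fun c => decide (c.eval 0).Dom, ?_, by simp⟩)
  refine (hd.comp (hM.to_comp.comp Computable.encode)).of_eq fun c => Part.eq_some_iff.2 ?_
  obtain ⟨b, hb, hbP⟩ := H _ (hMf (Encodable.encode c)).1
  replace hbP := hbP.trans (hMf (Encodable.encode c)).2
  rw [Denumerable.ofNat_encode] at hbP
  have : b = decide (c.eval 0).Dom := by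
    rw [Bool.eq_iff_iff, hbP, decide_eq_true_iff]
  subst this
  exact hb
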